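/- Let $X$ be a non-empty set of arbitrary cardinality and let $(X,r)$, $r(x,y)=({}^xy,x^y)$, be a \emph{solution}, i.e. an involutive non-degenerate set-theoretic solution of the Yang–Baxter equation: $r^2=\mathrm{id}$, all maps $\mathcal L_x:y\mapsto {}^xy$ and $\mathcal R_x:y\mapsto y^x$ are bijective, and $r^{12}r^{23}r^{12}=r^{23}r^{12}r^{23}$ on $X^3$. It is \emph{trivial} if $r(x,y)=(y,x)$ for all $x,y$, and it satisfies \textbf{lri} if $({}^xy)^x=y={}^x(y^x)$ for all $x,y$. Its retraction $\mathrm{Ret}(X,r)$ is the solution induced by $r$ on $X/{\sim}$, where $x\sim y$ iff $\mathcal L_x=\mathcal L_y$; $(X,r)$ is a multipermutation solution of level $m$, written $\mathrm{mpl}(X,r)=m$, if $m\ge 0$ is the least integer such that $\mathrm{Ret}^m(X,r)$ has exactly one element. Let $G=G(X,r)$ be the structure group, generated by $X$ with defining relations $xy=({}^xy)(x^y)$ for $x,y\in X$. Let $r_G:G\times G\to G\times G$, $r_G(a,b)=({}^ab,a^b)$, be the unique braiding operator on $G$ that restricts to $r$ on $X\times X$; that is, $r_G$ is bijective and, for all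 $a,b,u,v\in G$, ${}^a1=1$, ${}^1u=u$, $1^u=1$, $a^1=a$, ${}^{ab}u={}^a({}^bu)$, $a^{uv}=(a^u)^v$, ${}^a(uv)=({}^au)({}^{a^u}v)$, $(ab)^u=(a^{{}^bu})(b^u)$, $uv=({}^uv)(u^v)$. Then $(G,r_G)$ is itself a solution. Let $(G,+,\cdot)$ be the associated left brace, $a+b=a\cdot({}^{a^{-1}}b)$; it satisfies \textbf{Raut} if $(a+b)^c=a^c+b^c$ for all $a,b,c\in G$. The following conditions are equivalent. \begin{enumerate} \item $(G,r_G)$ is a non-trivial solution with condition \textbf{lri}. \item $(G,r_G)$ is a multipermutation solution of level $2$. \item $G$ acts non-trivially upon itself as automorphisms, that is, $\mathcal L_{(a^b)}=\mathcal L_a$ for all $a,b\in G$, and $\mathcal L_a\neq \mathrm{id}_G$ for some $a\in G$ (where $\mathcal L_a(b)={}^ab$). \item $(X,r)$ is a non-trivial solution with \textbf{lri}, and the left brace $(G,+,\cdot)$ satisfies \textbf{Raut}. \end{enumerate} Each of these conditions implies that $(X,r)$ is a multipermutation solution with $\mathrm{mpl}(X,r)\le 2$. -/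

import Mathlib

universe u

namespace YangBaxter

/-- The left component `ˣy` of `r (x, y) = (ˣy, xʸ)`. -/
abbrev lact {X : Type u} (r : X × X → X × X) (x y : X) : X := (r (x, y)).1

/-- The right component `xʸ` of `r (x, y) = (ˣy, xʸ)`. -/
abbrev ract {X : Type u} (r : X × X → X × X) (x y : X) : X := (r (x, y)).2

/-- `r × id` on `X × X × X`. -/
def r12 {X : Type u} (r : X × X → X × X) (t : X × X × X) : X × X × X :=
  ((r (t.1, t.2.1)).1, (r (t.1, t.2.1)).2, t.2.2)

/-- `id × r` on `X × X × X`. -/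
def r23 {X : Type u} (r : X × X → X × X) (t : X × X × X) : X × X × X :=
  (t.1, r t.2)

/-- An involutive non-degenerate set-theoretic solution of the Yang–Baxter equation on `X`. -/
structure Solution (X : Type u) where
  r : X × X → X × X
  involutive : Function.Involutive r
  left_bijective : ∀ x, Function.Bijective fun y => lact r x y
  right_bijective : ∀ x, Function.Bijective fun y => ract r y x
  braid : ∀ t, r12 r (r23 r (r12 r t)) = r23 r (r12 r (r23 r t))

namespace Solution

variable {X : Type u} (S : Solution X)

/-- The trivial solution is the flip. -/
def IsTrivial : Prop := ∀ x y, S.r (x, y) = (y, x)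

/-- Condition **lri**: `(ˣy)ˣ = y = ˣ(yˣ)`. -/
def Lri : Prop := ∀ x y, ract S.r (lact S.r x y) x = y ∧ lact S.r x (ract S.r y x) = y

theorem ll (x y : X) : lact S.r (lact S.r x y) (ract S.r x y) = x :=
  congrArg Prod.fst (S.involutive (x, y))

theorem rr (x y : X) : ract S.r (lact S.r x y) (ract S.r x y) = y :=
  congrArg Prod.snd (S.involutive (x, y))

theorem braid1 (x y z : X) :
    lact S.r (lact S.r x y) (lact S.r (ract S.r x y) z) = lact S.r x (lact S.r y z) :=
  congrArg (fun t => t.1) (S.braid (x, y, z))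

theorem braid3 (x y z : X) :
    ract S.r (ract S.r x y) z = ract S.r (ract S.r x (lact S.r y z)) (ract S.r y z) :=
  congrArg (fun t => t.2.2) (S.braid (x, y, z))

/-- The permutation `𝓛ₓ : y ↦ ˣy`. -/
noncomputable def L (x : X) : Equiv.Perm X := Equiv.ofBijective _ (S.left_bijective x)

/-- The permutation `𝓡ₓ : y ↦ yˣ`. -/
noncomputable def R (x : X) : Equiv.Perm X := Equiv.ofBijective _ (S.right_bijective x)

@[simp] theorem L_apply (x y : X) : S.L x y = lact S.r x y := rfl

@[simp] theorem R_apply (x y : X) : S.R x y = ract S.r y x := rfl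

theorem L_mul (x y : X) : S.L x * S.L y = S.L (lact S.r x y) * S.L (ract S.r x y) := by
  ext z; simpa using (S.braid1 x y z).symm

theorem R_mul (x y : X) : S.R y * S.R x = S.R (ract S.r x y) * S.R (lact S.r x y) := by
  ext z; simpa using S.braid3 z x y

theorem ract_eq (x y : X) : ract S.r x y = (S.L (lact S.r x y)).symm x := by
  rw [Equiv.eq_symm_apply]; exact S.ll x y

theorem lact_eq (x y : X) : lact S.r x y = (S.R (ract S.r x y)).symm y := by
  rw [Equiv.eq_symm_apply]; exact S.rr x y

/-- Cycle set identity, in the form `𝓛ₚ 𝓛_{p·q} = 𝓛_q 𝓛_{q·p}` with `p·q = 𝓛ₚ⁻¹ q`. -/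
theorem L_cycle (p q : X) :
    S.L p * S.L ((S.L p).symm q) = S.L q * S.L ((S.L q).symm p) := by
  have h : lact S.r p ((S.L p).symm q) = q := (S.L p).apply_symm_apply q
  rw [L_mul, ract_eq, h]

theorem R_cycle (p q : X) :
    S.R p * S.R ((S.R p).symm q) = S.R q * S.R ((S.R q).symm p) := by
  have h : ract S.r ((S.R p).symm q) p = q := (S.R p).apply_symm_apply q
  rw [R_mul, lact_eq, h]

/-- The diagonal map `y ↦ 𝓛_y⁻¹ y`, a bijection with inverse `y ↦ 𝓡_y⁻¹ y`. -/
noncomputable def diag : Equiv.Perm X where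
  toFun y := (S.L y).symm y
  invFun y := (S.R y).symm y
  left_inv y := by
    rw [Equiv.symm_apply_eq]
    have h : lact S.r y ((S.L y).symm y) = y := (S.L y).apply_symm_apply y
    change _ = ract S.r y ((S.L y).symm y)
    rw [ract_eq, h]
  right_inv y := by
    rw [Equiv.symm_apply_eq]
    have h : ract S.r ((S.R y).symm y) y = y := (S.R y).apply_symm_apply y
    change _ = lact S.r ((S.R y).symm y) y
    rw [lact_eq, h]

theorem diag_apply (y : X) : S.diag y = (S.L y).symm y := rfl

theorem diag_ract (q v : X) : S.diag (ract S.r q v) = (S.L v).symm (S.diag q) := by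
  -- put `p = ^q v`, so that `q^v = p·q` and `v = q·p`
  have h1 := S.ract_eq q v
  have h2 : v = (S.L q).symm (lact S.r q v) := ((S.L q).symm_apply_apply v).symm
  generalize lact S.r q v = p at h1 h2
  have h := S.L_cycle p q
  rw [← h1, ← h2] at h
  have h3 := DFunLike.congr_fun (congrArg (·⁻¹) h) q
  simp only [mul_inv_rev, Equiv.Perm.mul_apply, Equiv.Perm.inv_def] at h3
  rw [← h1] at h3
  exact h3

/-- The retraction relation `x ∼ y ↔ 𝓛ₓ = 𝓛_y`. -/
def retSetoid : Setoid X where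
  r x y := S.L x = S.L y
  iseqv := ⟨fun _ => rfl, Eq.symm, Eq.trans⟩

theorem R_eq_of_L_eq {x y : X} (h : S.L x = S.L y) : S.R x = S.R y := by
  ext q
  apply S.diag.injective
  simp [diag_ract, h]

theorem L_eq_of_R_eq {x y : X} (h : S.R x = S.R y) : S.L x = S.L y := by
  suffices (S.L x)⁻¹ = (S.L y)⁻¹ from inv_injective this
  ext q
  obtain ⟨q, rfl⟩ := S.diag.surjective q
  have := S.diag_ract q x
  have h' : ract S.r q x = ract S.r q y := DFunLike.congr_fun h q
  rw [h', diag_ract] at this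
  exact this.symm

theorem ret_L_symm (p : X) {q q' : X} (h : S.L q = S.L q') :
    S.L ((S.L p).symm q) = S.L ((S.L p).symm q') := by
  have h1 := S.L_cycle p q
  rw [h, ← S.L_cycle p q'] at h1
  exact mul_left_cancel h1

theorem ret_R_symm (p : X) {q q' : X} (h : S.L q = S.L q') :
    S.L ((S.R p).symm q) = S.L ((S.R p).symm q') := by
  apply S.L_eq_of_R_eq
  have h1 := S.R_cycle p q
  rw [S.R_eq_of_L_eq h, ← S.R_cycle p q'] at h1
  exact mul_left_cancel h1

theorem ret_lact {x x' y y' : X} (hx : S.L x = S.L x') (hy : S.L y = S.L y') :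
    S.L (lact S.r x y) = S.L (lact S.r x' y') := by
  have e : lact S.r x y = lact S.r x' y := DFunLike.congr_fun hx y
  have e2 : ract S.r x' y = ract S.r x' y' := DFunLike.congr_fun (S.R_eq_of_L_eq hy) x'
  rw [e, lact_eq, lact_eq S x' y', e2]
  exact S.ret_R_symm _ hy

theorem ret_ract {x x' y y' : X} (hx : S.L x = S.L x') (hy : S.L y = S.L y') :
    S.L (ract S.r x y) = S.L (ract S.r x' y') := by
  have h := S.ret_lact hx hy
  rw [ract_eq, ract_eq S x' y', h]
  exact S.ret_L_symm _ hx

/-- The map induced by `r` on the set of `∼`-classes: `r ([x], [y]) = ([ˣy], [xʸ])`. -/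
def retMap : Quotient S.retSetoid × Quotient S.retSetoid →
    Quotient S.retSetoid × Quotient S.retSetoid :=
  fun p =>
    (Quotient.map₂ (lact S.r) (fun _ _ hx _ _ hy => S.ret_lact hx hy) p.1 p.2,
      Quotient.map₂ (ract S.r) (fun _ _ hx _ _ hy => S.ret_ract hx hy) p.1 p.2)

theorem retMap_mk (x y : X) :
    S.retMap (Quotient.mk S.retSetoid x, Quotient.mk S.retSetoid y) =
      (Quotient.mk S.retSetoid (lact S.r x y), Quotient.mk S.retSetoid (ract S.r x y)) := rfl

/-- The retraction `Ret (X, r)`. -/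
def retract : Solution (Quotient S.retSetoid) where
  r := S.retMap
  involutive := by
    rintro ⟨x, y⟩
    induction x using Quotient.inductionOn
    induction y using Quotient.inductionOn
    simp only [retMap_mk, S.ll, S.rr]
  left_bijective x := by
    induction x using Quotient.inductionOn with | _ x
    constructor
    · intro y z h
      induction y using Quotient.inductionOn with | _ y
      induction z using Quotient.inductionOn with | _ z
      have h' : S.L (S.L x y) = S.L (S.L x z) := Quotient.exact h
      have := S.ret_L_symm x h'
      simp only [Equiv.symm_apply_apply] at this
      exact Quotient.sound this
    · intro y
      induction y using Quotient.inductionOn with | _ y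
      refine ⟨Quotient.mk _ ((S.L x).symm y), ?_⟩
      change Quotient.mk S.retSetoid (S.L x ((S.L x).symm y)) = _
      simp only [Equiv.apply_symm_apply]
  right_bijective x := by
    induction x using Quotient.inductionOn with | _ x
    constructor
    · intro y z h
      induction y using Quotient.inductionOn with | _ y
      induction z using Quotient.inductionOn with | _ z
      have h' : S.L (S.R x y) = S.L (S.R x z) := Quotient.exact h
      have := S.ret_R_symm x h'
      simp only [Equiv.symm_apply_apply] at this
      exact Quotient.sound this
    · intro y
      induction y using Quotient.inductionOn with | _ y
      refine ⟨Quotient.mk _ ((S.R x).symm y), ?_⟩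
      change Quotient.mk S.retSetoid (S.R x ((S.R x).symm y)) = _
      simp only [Equiv.apply_symm_apply]
  braid := by
    rintro ⟨x, y, z⟩
    induction x using Quotient.inductionOn with | _ x
    induction y using Quotient.inductionOn with | _ y
    induction z using Quotient.inductionOn with | _ z
    exact congrArg (fun t : X × X × X =>
      ((Quotient.mk S.retSetoid t.1, Quotient.mk S.retSetoid t.2.1,
        Quotient.mk S.retSetoid t.2.2) :
        Quotient S.retSetoid × Quotient S.retSetoid × Quotient S.retSetoid)) (S.braid (x, y, z))

/-- `S.RetIsPoint m`: the `m`-fold retraction `Retᵐ (X, r)` has exactly one element. -/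
def RetIsPoint : ℕ → ∀ {X : Type u}, Solution X → Prop
  | 0, X, _ => Nat.card X = 1
  | m + 1, _, S => RetIsPoint m S.retract

/-- `(X, r)` is a multipermutation solution of level `m`: `m` is the least number such that
`Retᵐ (X, r)` has exactly one element. -/
def HasMpl (m : ℕ) : Prop := IsLeast {k | RetIsPoint k S} m

end Solution

/-- A braiding operator on a group. -/
structure IsBraidingOperator {G : Type u} [Group G] (r : G × G → G × G) : Prop where
  bijective : Function.Bijective r
  ml0 : ∀ a, lact r a 1 = 1
  ml0' : ∀ u, lact r 1 u = u
  mr0 : ∀ u, ract r 1 u = 1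
  mr0' : ∀ a, ract r a 1 = a
  ml1 : ∀ a b u, lact r (a * b) u = lact r a (lact r b u)
  mr1 : ∀ a u v, ract r a (u * v) = ract r (ract r a u) v
  ml2 : ∀ a u v, lact r a (u * v) = lact r a u * lact r (ract r a u) v
  mr2 : ∀ a b u, ract r (a * b) u = ract r a (lact r b u) * ract r b u
  m3 : ∀ u v, u * v = lact r u v * ract r u v

/-- A symmetric group (in the sense of Takeuchi) on the group `G`: an involutive braiding
operator. -/
structure SymmetricGroup (G : Type u) [Group G] where
  r : G × G → G × G
  isBraidingOperator : IsBraidingOperator r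
  involutive : Function.Involutive r

/-- A left brace with multiplicative group `G`. -/
structure LeftBrace (G : Type u) [Group G] where
  add : G → G → G
  zero : G
  neg : G → G
  add_assoc : ∀ a b c, add (add a b) c = add a (add b c)
  add_comm : ∀ a b, add a b = add b a
  zero_add : ∀ a, add zero a = a
  neg_add_cancel : ∀ a, add (neg a) a = zero
  brace : ∀ a b c, add (a * add b c) a = add (a * b) (a * c)

namespace SymmetricGroup

variable {G : Type u} [Group G] (B : SymmetricGroup G)

theorem m3 (u v : G) : lact B.r u v * ract B.r u v = u * v :=
  (B.isBraidingOperator.m3 u v).symm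

theorem ml1 (a b u : G) : lact B.r a (lact B.r b u) = lact B.r (a * b) u :=
  (B.isBraidingOperator.ml1 a b u).symm

theorem mr1 (a u v : G) : ract B.r (ract B.r a u) v = ract B.r a (u * v) :=
  (B.isBraidingOperator.mr1 a u v).symm

theorem lact_inv (a u : G) : lact B.r a (lact B.r a⁻¹ u) = u := by
  rw [ml1, mul_inv_cancel, B.isBraidingOperator.ml0']

theorem inv_lact (a u : G) : lact B.r a⁻¹ (lact B.r a u) = u := by
  rw [ml1, inv_mul_cancel, B.isBraidingOperator.ml0']

/-- A symmetric group is an involutive non-degenerate solution. -/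
def toSolution : Solution G where
  r := B.r
  involutive := B.involutive
  left_bijective x := Function.bijective_iff_has_inverse.2
    ⟨fun y => lact B.r x⁻¹ y, fun y => B.inv_lact x y, fun y => B.lact_inv x y⟩
  right_bijective x := Function.bijective_iff_has_inverse.2
    ⟨fun y => ract B.r y x⁻¹,
      fun y => by
        change ract B.r (ract B.r y x) x⁻¹ = y
        rw [mr1, mul_inv_cancel, B.isBraidingOperator.mr0'],
      fun y => by
        change ract B.r (ract B.r y x⁻¹) x = y
        rw [mr1, inv_mul_cancel, B.isBraidingOperator.mr0']⟩
  braid := by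
    rintro ⟨a, b, c⟩
    have h1 : lact B.r (lact B.r a b) (lact B.r (ract B.r a b) c) =
        lact B.r a (lact B.r b c) := by rw [ml1, ml1, m3]
    have h3 : ract B.r (ract B.r a b) c =
        ract B.r (ract B.r a (lact B.r b c)) (ract B.r b c) := by rw [mr1, mr1, m3]
    have h2 : ract B.r (lact B.r a b) (lact B.r (ract B.r a b) c) =
        lact B.r (ract B.r a (lact B.r b c)) (ract B.r b c) := by
      have e1 : lact B.r (lact B.r a b) (lact B.r (ract B.r a b) c) *
          ract B.r (lact B.r a b) (lact B.r (ract B.r a b) c) *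
          ract B.r (ract B.r a b) c = a * b * c := by
        rw [m3, mul_assoc, m3, ← mul_assoc, m3]
      have e2 : lact B.r a (lact B.r b c) *
          lact B.r (ract B.r a (lact B.r b c)) (ract B.r b c) *
          ract B.r (ract B.r a (lact B.r b c)) (ract B.r b c) = a * b * c := by
        rw [mul_assoc, m3, ← mul_assoc, m3, mul_assoc, m3, mul_assoc]
      rw [← e2, h1, h3] at e1
      exact mul_left_cancel (mul_right_cancel e1)
    exact Prod.ext h1 (Prod.ext h2 h3)

theorem lact_mul_lact_inv (a b c : G) :
    lact B.r a (b * lact B.r b⁻¹ c) =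
      lact B.r a b * lact B.r (lact B.r a b)⁻¹ (lact B.r a c) := by
  rw [B.isBraidingOperator.ml2, ml1, ml1]
  have h : ract B.r a b * b⁻¹ = (lact B.r a b)⁻¹ * a := by
    rw [eq_inv_mul_iff_mul_eq, ← mul_assoc, m3, mul_inv_cancel_right]
  rw [h]

theorem add_comm_aux (a b : G) : a * lact B.r a⁻¹ b = b * lact B.r b⁻¹ a := by
  have h := B.m3 a (lact B.r a⁻¹ b)
  have h2 : lact B.r (lact B.r a (lact B.r a⁻¹ b)) (ract B.r a (lact B.r a⁻¹ b)) = a :=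
    B.toSolution.ll a (lact B.r a⁻¹ b)
  rw [lact_inv] at h h2
  rw [← h]
  conv_rhs => rw [← h2]
  rw [inv_lact]

theorem add_assoc_aux (a b c : G) :
    (a * lact B.r a⁻¹ b) * lact B.r (a * lact B.r a⁻¹ b)⁻¹ c =
      a * lact B.r a⁻¹ (b * lact B.r b⁻¹ c) := by
  rw [lact_mul_lact_inv, ml1, mul_inv_rev, mul_assoc]

/-- The left brace associated to a symmetric group: `a + b = a · (^{a⁻¹} b)`. -/
def brace : LeftBrace G where
  add a b := a * lact B.r a⁻¹ b
  zero := 1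
  neg a := lact B.r a a⁻¹
  add_assoc a b c := B.add_assoc_aux a b c
  add_comm a b := B.add_comm_aux a b
  zero_add a := by simp only [inv_one, one_mul, B.isBraidingOperator.ml0']
  neg_add_cancel a := by
    rw [B.add_comm_aux, inv_lact, mul_inv_cancel]
  brace a b c := by
    have key : ∀ u, a * u = a * lact B.r a⁻¹ (lact B.r a u) := fun u => by rw [inv_lact]
    have laut := B.lact_mul_lact_inv a b c
    have assoc := B.add_assoc_aux
    have comm := B.add_comm_aux
    rw [key (b * lact B.r b⁻¹ c), laut, key b, key c]
    generalize lact B.r a b = p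
    generalize lact B.r a c = q
    generalize hs : (fun u v => u * lact B.r u⁻¹ v) = s
    have hs' : ∀ u v, u * lact B.r u⁻¹ v = s u v := fun u v => by rw [← hs]
    simp only [hs'] at assoc comm ⊢
    rw [assoc, assoc, assoc, comm q a]

/-- Condition **Raut** on the left brace of a symmetric group: `(a + b)ᶜ = aᶜ + bᶜ`. -/
def Raut : Prop :=
  ∀ a b c, ract B.r (B.brace.add a b) c = B.brace.add (ract B.r a c) (ract B.r b c)

end SymmetricGroup

namespace Solution

variable {X : Type u} (S : Solution X)

/-- The defining relations `x y = (ˣy) (xʸ)` of the structure group. -/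
def rels : Set (FreeGroup X) :=
  {w | ∃ x y, w = FreeGroup.of x * FreeGroup.of y *
    (FreeGroup.of (lact S.r x y) * FreeGroup.of (ract S.r x y))⁻¹}

/-- The structure group `G(X, r)`. -/
abbrev StructureGroup : Type u := PresentedGroup S.rels

/-- The canonical map `X → G(X, r)`. -/
def ι (x : X) : S.StructureGroup := PresentedGroup.of x

theorem ι_rel (x y : X) : S.ι x * S.ι y = S.ι (lact S.r x y) * S.ι (ract S.r x y) := by
  rw [← mul_inv_eq_one]
  exact PresentedGroup.one_of_mem ⟨x, y, rfl⟩

theorem closure_ι : Subgroup.closure (Set.range S.ι) = ⊤ :=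
  PresentedGroup.closure_range_of S.rels

/-- A map of `X` to a group that respects the defining relations extends to `G(X, r)`. -/
def lift {H : Type*} [Group H] (f : X → H)
    (hf : ∀ x y, f x * f y = f (lact S.r x y) * f (ract S.r x y)) : S.StructureGroup →* H :=
  PresentedGroup.toGroup (f := f) (by
    rintro _ ⟨x, y, rfl⟩
    rw [map_mul, map_mul, map_inv, map_mul, mul_inv_eq_one]
    simpa only [FreeGroup.lift_apply_of] using hf x y)

@[simp] theorem lift_ι {H : Type*} [Group H] (f : X → H)
    (hf : ∀ x y, f x * f y = f (lact S.r x y) * f (ract S.r x y)) (x : X) :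
    S.lift f hf (S.ι x) = f x :=
  PresentedGroup.toGroup.of _

/-- The left action of `G(X, r)` on `X`, extending `x ↦ 𝓛ₓ`. -/
noncomputable def act : S.StructureGroup →* Equiv.Perm X := S.lift S.L S.L_mul

@[simp] theorem act_ι (x : X) : S.act (S.ι x) = S.L x := S.lift_ι _ _ _

/-- The additive action of a permutation of `X` on the free abelian group on `X`. -/
noncomputable def permAct (σ : Equiv.Perm X) : (X →₀ ℤ) ≃+ (X →₀ ℤ) := Finsupp.domCongr σ

@[simp] theorem permAct_single (σ : Equiv.Perm X) (x : X) (n : ℤ) :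
    permAct σ (Finsupp.single x n) = Finsupp.single (σ x) n := by
  simp [permAct]

theorem permAct_mul (σ τ : Equiv.Perm X) (a : X →₀ ℤ) :
    permAct (σ * τ) a = permAct σ (permAct τ a) := by
  ext x; simp only [permAct, Finsupp.domCongr_apply, Finsupp.equivMapDomain_apply]; rfl

theorem permAct_one (a : X →₀ ℤ) : permAct 1 a = a := by
  ext x; simp only [permAct, Finsupp.domCongr_apply, Finsupp.equivMapDomain_apply]; rfl

/-- The affine action of `G(X, r)` on the free abelian group on `X`: `x` acts by
`a ↦ x + 𝓛ₓ a`. -/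
noncomputable def aff : S.StructureGroup →* Equiv.Perm (X →₀ ℤ) :=
  S.lift (fun x => (permAct (S.L x)).toEquiv.trans (Equiv.addLeft (Finsupp.single x 1)))
    (by
      intro x y
      ext1 a
      simp only [Equiv.Perm.mul_apply, Equiv.trans_apply, AddEquiv.toEquiv_eq_coe,
        AddEquiv.coe_toEquiv, Equiv.coe_addLeft, map_add, permAct_single, ← permAct_mul,
        L_apply, S.ll, S.L_mul x y]
      abel)

/-- The bijective 1-cocycle `π : G(X, r) → ℤ^(X)` with `π x = x`, `π (g h) = π g + ᵍ(π h)`. -/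
noncomputable def cocycle (g : S.StructureGroup) : X →₀ ℤ := S.aff g 0

theorem aff_ι (x : X) (a : X →₀ ℤ) :
    S.aff (S.ι x) a = Finsupp.single x 1 + permAct (S.L x) a := by
  simp [aff]

theorem aff_apply (g : S.StructureGroup) (a : X →₀ ℤ) :
    S.aff g a = S.cocycle g + permAct (S.act g) a := by
  have hg : g ∈ Subgroup.closure (Set.range S.ι) := by rw [closure_ι]; trivial
  induction hg using Subgroup.closure_induction generalizing a with
  | mem _ h => obtain ⟨x, rfl⟩ := h; simp [cocycle, aff_ι]
  | one => simp [cocycle, permAct_one]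
  | mul g h _ _ ihg ihh =>
    rw [cocycle, map_mul, map_mul, Equiv.Perm.mul_apply, Equiv.Perm.mul_apply, ihg, ihh, ihg,
      ihh 0, map_add, map_add, permAct_mul, map_zero, map_zero]
    abel
  | inv g _ ih =>
    have h0 : ∀ c, S.aff g (S.aff g⁻¹ c) = c := fun c => by
      rw [← Equiv.Perm.mul_apply, ← map_mul, mul_inv_cancel, map_one, Equiv.Perm.one_apply]
    apply (S.aff g).injective
    rw [h0, ih, map_add, ← permAct_mul, ← map_mul, mul_inv_cancel, map_one, permAct_one,
      ← add_assoc, ← ih, cocycle, h0, zero_add]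

theorem cocycle_mul (g h : S.StructureGroup) :
    S.cocycle (g * h) = S.cocycle g + permAct (S.act g) (S.cocycle h) := by
  rw [← aff_apply, cocycle, cocycle, map_mul, Equiv.Perm.mul_apply]

theorem cocycle_one : S.cocycle 1 = 0 := by simp [cocycle]

@[simp] theorem cocycle_ι (x : X) : S.cocycle (S.ι x) = Finsupp.single x 1 := by
  simp [cocycle, aff_ι]

theorem act_inv_mul_ι (g : S.StructureGroup) (p y : X) :
    S.act (g * S.ι p)⁻¹ y = (S.L p).symm (S.act g⁻¹ y) := by
  rw [mul_inv_rev, map_mul, Equiv.Perm.mul_apply, map_inv, act_ι]; rfl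

/-- The permutation `g ↦ g + x` of `G(X, r)`. -/
noncomputable def shift (x : X) : Equiv.Perm S.StructureGroup where
  toFun g := g * S.ι (S.act g⁻¹ x)
  invFun g := g * (S.ι (S.diag.symm (S.act g⁻¹ x)))⁻¹
  left_inv g := by
    simp only [act_inv_mul_ι, ← diag_apply, Equiv.symm_apply_apply, mul_inv_cancel_right]
  right_inv g := by
    have h : S.act (g * (S.ι (S.diag.symm (S.act g⁻¹ x)))⁻¹)⁻¹ x =
        S.diag.symm (S.act g⁻¹ x) := by
      rw [mul_inv_rev, inv_inv, map_mul, Equiv.Perm.mul_apply, act_ι]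
      generalize S.act g⁻¹ x = y
      rw [← Equiv.eq_symm_apply, ← diag_apply, Equiv.apply_symm_apply]
    simp only [h, inv_mul_cancel_right]

theorem shift_apply (x : X) (g : S.StructureGroup) : S.shift x g = g * S.ι (S.act g⁻¹ x) := rfl

theorem shift_comm (x y : X) : S.shift x * S.shift y = S.shift y * S.shift x := by
  ext g
  simp only [Equiv.Perm.mul_apply, shift_apply, act_inv_mul_ι]
  generalize S.act g⁻¹ x = p
  generalize S.act g⁻¹ y = q
  rw [mul_assoc, mul_assoc, ι_rel, ract_eq]
  have h : lact S.r q ((S.L q).symm p) = p := (S.L q).apply_symm_apply p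
  rw [h]

theorem cocycle_bijective : Function.Bijective S.cocycle := by
  have hcomm : ∀ a ∈ Set.range S.shift, ∀ b ∈ Set.range S.shift, a * b = b * a := by
    rintro _ ⟨x, rfl⟩ _ ⟨y, rfl⟩
    exact S.shift_comm x y
  have hcl := Subgroup.isMulCommutative_closure hcomm
  let : CommGroup (Subgroup.closure (Set.range S.shift)) :=
    { (inferInstance : Group (Subgroup.closure (Set.range S.shift))) with
      mul_comm := hcl.is_comm.comm }
  let τ : (X →₀ ℤ) →+ Additive (Subgroup.closure (Set.range S.shift)) :=
    Finsupp.liftAddHom fun x => zmultiplesHom _ (Additive.ofMul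
      ⟨S.shift x, Subgroup.subset_closure ⟨x, rfl⟩⟩)
  have hτ : ∀ x, ((τ (Finsupp.single x 1)).toMul : Equiv.Perm S.StructureGroup) = S.shift x := by
    intro x; simp [τ]
  have hτadd : ∀ a b, ((τ (a + b)).toMul : Equiv.Perm S.StructureGroup) =
      (τ b).toMul * (τ a).toMul := by
    intro a b; rw [add_comm, map_add]; rfl
  let s : (X →₀ ℤ) → S.StructureGroup := fun a =>
    ((τ a).toMul : Equiv.Perm S.StructureGroup) 1
  have hs : ∀ a x, s (a + Finsupp.single x 1) = S.shift x (s a) := by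
    intro a x
    simp only [s]
    rw [hτadd, hτ, Equiv.Perm.mul_apply]
  have hleft : ∀ g, s (S.cocycle g) = g := by
    intro g
    have hg : g ∈ Subgroup.closure (Set.range S.ι) := by rw [closure_ι]; trivial
    induction hg using Subgroup.closure_induction_right with
    | one => rw [cocycle_one]; simp [s]
    | mul_right g _ _ h ih =>
      obtain ⟨x, rfl⟩ := h
      rw [cocycle_mul, cocycle_ι, permAct_single, hs, ih, shift_apply, ← Equiv.Perm.mul_apply,
        ← map_mul, inv_mul_cancel, map_one, Equiv.Perm.one_apply]
    | mul_inv_cancel g _ _ h ih =>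
      obtain ⟨x, rfl⟩ := h
      have e : S.cocycle g = S.cocycle (g * (S.ι x)⁻¹) +
          Finsupp.single (S.act (g * (S.ι x)⁻¹) x) 1 := by
        conv_lhs => rw [← inv_mul_cancel_right g (S.ι x)]
        rw [cocycle_mul, cocycle_ι, permAct_single]
      rw [e, hs] at ih
      apply (S.shift _).injective
      rw [ih, shift_apply, ← Equiv.Perm.mul_apply, ← map_mul, inv_mul_cancel, map_one,
        Equiv.Perm.one_apply, inv_mul_cancel_right]
  have hshift : ∀ x g, S.cocycle (S.shift x g) = S.cocycle g + Finsupp.single x 1 := by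
    intro x g
    rw [shift_apply, cocycle_mul, cocycle_ι, permAct_single, ← Equiv.Perm.mul_apply,
      ← map_mul, mul_inv_cancel, map_one, Equiv.Perm.one_apply]
  refine ⟨Function.LeftInverse.injective hleft, fun a => ?_⟩
  have key : ∀ (x : X) (n : ℤ) (b : X →₀ ℤ), b ∈ Set.range S.cocycle →
      b + Finsupp.single x n ∈ Set.range S.cocycle := by
    intro x n
    induction n using Int.induction_on with
    | zero => intro b hb; simpa using hb
    | succ n ih =>
      intro b hb
      obtain ⟨g, hg⟩ := ih b hb
      refine ⟨S.shift x g, ?_⟩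
      rw [hshift, hg, Finsupp.single_add]; abel
    | pred n ih =>
      intro b hb
      obtain ⟨g, hg⟩ := ih b hb
      refine ⟨(S.shift x).symm g, ?_⟩
      have := hshift x ((S.shift x).symm g)
      rw [Equiv.apply_symm_apply, hg] at this
      rw [Finsupp.single_sub, ← add_sub_assoc, this, add_sub_cancel_right]
  induction a using Finsupp.induction with
  | zero => exact ⟨1, S.cocycle_one⟩
  | single_add x n a _ _ ih => rw [add_comm]; exact key x n a ih

/-- The cocycle as a bijection. -/
noncomputable def cocycleEquiv : S.StructureGroup ≃ (X →₀ ℤ) :=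
  Equiv.ofBijective S.cocycle S.cocycle_bijective

/-- The left action of `G(X, r)` on itself, transported from its action on `ℤ^(X)`. -/
noncomputable def gLeft (a b : S.StructureGroup) : S.StructureGroup :=
  S.cocycleEquiv.symm (permAct (S.act a) (S.cocycle b))

@[simp] theorem cocycle_gLeft (a b : S.StructureGroup) :
    S.cocycle (S.gLeft a b) = permAct (S.act a) (S.cocycle b) :=
  S.cocycleEquiv.apply_symm_apply _

/-- `r_G (a, b) = (ᵃb, aᵇ)`, where `aᵇ` is `^{(ᵃb)⁻¹} a`. -/
noncomputable def gMap (p : S.StructureGroup × S.StructureGroup) :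
    S.StructureGroup × S.StructureGroup :=
  (S.gLeft p.1 p.2, S.gLeft (S.gLeft p.1 p.2)⁻¹ p.1)

theorem gLeft_mul (a b u : S.StructureGroup) :
    S.gLeft (a * b) u = S.gLeft a (S.gLeft b u) := by
  apply S.cocycle_bijective.1
  simp [permAct_mul]

theorem gLeft_one (u : S.StructureGroup) : S.gLeft 1 u = u := by
  apply S.cocycle_bijective.1
  simp [permAct_one]

theorem gLeft_self_inv (a u : S.StructureGroup) : S.gLeft a (S.gLeft a⁻¹ u) = u := by
  rw [← gLeft_mul, mul_inv_cancel, gLeft_one]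

theorem gM3 (a b : S.StructureGroup) :
    S.gLeft a b * S.gLeft (S.gLeft a b)⁻¹ a = a * b := by
  apply S.cocycle_bijective.1
  rw [cocycle_mul, ← cocycle_gLeft, gLeft_self_inv, cocycle_mul, cocycle_gLeft, add_comm]

theorem gML2 (a u v : S.StructureGroup) :
    S.gLeft a (u * v) = S.gLeft a u * S.gLeft (S.gLeft (S.gLeft a u)⁻¹ a) v := by
  apply S.cocycle_bijective.1
  rw [cocycle_gLeft, cocycle_mul, cocycle_mul, map_add, cocycle_gLeft, cocycle_gLeft,
    ← permAct_mul, ← permAct_mul, ← map_mul, ← map_mul, gM3]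

theorem gMap_involutive : Function.Involutive S.gMap := by
  rintro ⟨a, b⟩
  have h : S.gLeft (S.gLeft a b) (S.gLeft (S.gLeft a b)⁻¹ a) = a := S.gLeft_self_inv _ _
  simp only [gMap, h]
  rw [← gLeft_mul, inv_mul_cancel, gLeft_one]

theorem gMap_isBraidingOperator : IsBraidingOperator S.gMap where
  bijective := S.gMap_involutive.bijective
  ml0 a := by
    change S.gLeft a 1 = 1
    apply S.cocycle_bijective.1
    simp [cocycle_one]
  ml0' := S.gLeft_one
  mr0 u := by
    change S.gLeft _ 1 = 1
    apply S.cocycle_bijective.1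
    simp [cocycle_one]
  mr0' a := by
    have h : S.gLeft a 1 = 1 := by
      apply S.cocycle_bijective.1
      simp [cocycle_one]
    change S.gLeft (S.gLeft a 1)⁻¹ a = a
    rw [h, inv_one, gLeft_one]
  ml1 := S.gLeft_mul
  mr1 a u v := by
    have h1 := S.gM3 a (u * v)
    rw [← mul_assoc, ← S.gM3 a u, mul_assoc _ _ v,
      ← S.gM3 (S.gLeft (S.gLeft a u)⁻¹ a) v, ← mul_assoc, ← gML2] at h1
    exact mul_left_cancel h1
  ml2 := S.gML2
  mr2 a b u := by
    have h1 := S.gM3 (a * b) u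
    rw [mul_assoc, ← S.gM3 b u, ← mul_assoc a, ← S.gM3 a (S.gLeft b u), mul_assoc] at h1
    conv at h1 => lhs; arg 1; rw [gLeft_mul]
    exact mul_left_cancel h1
  m3 u v := (S.gM3 u v).symm

/-- The symmetric group `(G, r_G)` associated to `(X, r)`. -/
noncomputable def symmetricGroup : SymmetricGroup S.StructureGroup where
  r := S.gMap
  isBraidingOperator := S.gMap_isBraidingOperator
  involutive := S.gMap_involutive

/-- `r_G` restricts to `r` on `X × X`. -/
theorem symmetricGroup_r_ι (x y : X) :
    S.symmetricGroup.r (S.ι x, S.ι y) = (S.ι (lact S.r x y), S.ι (ract S.r x y)) := by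
  have h : S.gLeft (S.ι x) (S.ι y) = S.ι (lact S.r x y) := by
    apply S.cocycle_bijective.1
    simp
  refine Prod.ext h ?_
  change S.gLeft (S.gLeft (S.ι x) (S.ι y))⁻¹ (S.ι x) = S.ι (ract S.r x y)
  have h2 := S.gM3 (S.ι x) (S.ι y)
  rw [h, ι_rel] at h2
  rw [h]
  exact mul_left_cancel h2

theorem ι_injective : Function.Injective S.ι := by
  intro x y h
  have := congrArg S.cocycle h
  simpa using (Finsupp.single_left_injective (one_ne_zero (α := ℤ))) (by simpa using this)

/-- `r_G` is the only braiding operator on `G(X, r)` that restricts to `r` on `X × X`. -/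
theorem braidingOperator_unique (ρ : S.StructureGroup × S.StructureGroup →
      S.StructureGroup × S.StructureGroup) (hρ : IsBraidingOperator ρ)
    (hext : ∀ x y, ρ (S.ι x, S.ι y) = (S.ι (lact S.r x y), S.ι (ract S.r x y))) :
    ρ = S.symmetricGroup.r := by
  have hG : IsBraidingOperator S.symmetricGroup.r := S.symmetricGroup.isBraidingOperator
  have hextG := S.symmetricGroup_r_ι
  generalize S.symmetricGroup.r = γ at hG hextG
  have step1 : ∀ u, ∃ σ : Equiv.Perm X, ∀ x, ract ρ (S.ι x) u = S.ι (σ x) ∧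
      ract γ (S.ι x) u = S.ι (σ x) ∧ lact ρ (S.ι x) u = lact γ (S.ι x) u := by
    intro u
    have hu : u ∈ Subgroup.closure (Set.range S.ι) := by rw [closure_ι]; trivial
    induction hu using Subgroup.closure_induction with
    | mem _ h =>
      obtain ⟨y, rfl⟩ := h
      exact ⟨S.R y, fun x => by simp [lact, ract, hext, hextG]⟩
    | one => exact ⟨1, fun x => by simp [hρ.mr0', hG.mr0', hρ.ml0, hG.ml0]⟩
    | mul u v _ _ ihu ihv =>
      obtain ⟨σ, hσ⟩ := ihu
      obtain ⟨τ, hτ⟩ := ihv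
      refine ⟨τ * σ, fun x => ?_⟩
      obtain ⟨h1, h2, h3⟩ := hσ x
      obtain ⟨k1, k2, k3⟩ := hτ (σ x)
      refine ⟨?_, ?_, ?_⟩
      · rw [hρ.mr1, h1, k1]; rfl
      · rw [hG.mr1, h2, k2]; rfl
      · rw [hρ.ml2, hG.ml2, h1, h2, h3, k3]
    | inv u _ ih =>
      obtain ⟨σ, hσ⟩ := ih
      refine ⟨σ⁻¹, fun x => ?_⟩
      obtain ⟨h1, h2, h3⟩ := hσ (σ⁻¹ x)
      have h0 : σ (σ⁻¹ x) = x := σ.apply_symm_apply x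
      rw [h0] at h1 h2
      have e1 : ract ρ (S.ι x) u⁻¹ = S.ι (σ⁻¹ x) := by
        rw [← h1, ← hρ.mr1, mul_inv_cancel, hρ.mr0']
      have e2 : ract γ (S.ι x) u⁻¹ = S.ι (σ⁻¹ x) := by
        rw [← h2, ← hG.mr1, mul_inv_cancel, hG.mr0']
      refine ⟨e1, e2, ?_⟩
      have f1 := hρ.ml2 (S.ι x) u⁻¹ u
      have f2 := hG.ml2 (S.ι x) u⁻¹ u
      rw [inv_mul_cancel, hρ.ml0, e1, h3] at f1
      rw [inv_mul_cancel, hG.ml0, e2] at f2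
      exact mul_right_cancel (f1.symm.trans f2)
  have step2 : ∀ g u, lact ρ g u = lact γ g u := by
    intro g
    have hg : g ∈ Subgroup.closure (Set.range S.ι) := by rw [closure_ι]; trivial
    induction hg using Subgroup.closure_induction with
    | mem _ h =>
      obtain ⟨x, rfl⟩ := h
      intro u
      obtain ⟨σ, hσ⟩ := step1 u
      exact (hσ x).2.2
    | one => intro u; rw [hρ.ml0', hG.ml0']
    | mul g h _ _ ihg ihh => intro u; rw [hρ.ml1, hG.ml1, ihg, ihh]
    | inv g _ ih =>
      intro u
      have e : u = lact ρ g (lact γ g⁻¹ u) := by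
        rw [ih, ← hG.ml1, mul_inv_cancel, hG.ml0']
      conv_lhs => rw [e]
      rw [← hρ.ml1, inv_mul_cancel, hρ.ml0']
  funext p
  obtain ⟨a, b⟩ := p
  refine Prod.ext (step2 a b) ?_
  have h1 := hρ.m3 a b
  rw [hG.m3 a b, step2 a b] at h1
  exact (mul_left_cancel h1).symm

/-- `(G, r_G)` as a solution. -/
noncomputable abbrev groupSolution : Solution S.StructureGroup := S.symmetricGroup.toSolution

/-- `G` acts nontrivially on itself as automorphisms:
`𝓛_{aᵇ} = 𝓛ₐ` for all `a, b ∈ G`, and `𝓛ₐ ≠ id` for some `a ∈ G`. -/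
def ActsNontriviallyByAutomorphisms : Prop :=
  (∀ a b, S.groupSolution.L (ract S.symmetricGroup.r a b) = S.groupSolution.L a) ∧
    ∃ a, S.groupSolution.L a ≠ Equiv.refl S.StructureGroup

end Solution

end YangBaxter

namespace YangBaxter

namespace Solution

/-! ### Retraction levels and **lri** for an arbitrary solution. -/

section Retraction

variable {X : Type u} (S : Solution X)

/-! All four conditions reduce to the first, and the pivot is the identity `𝓛_{ᵃb} = 𝓛_b` on `G`.

By involutivity `aᵇ = 𝓛_{ᵃb}⁻¹ a`, so the identity gives `aᵇ = 𝓛_b⁻¹ a`, which is **lri**; again by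
involutivity it is equivalent to `𝓛_{aᵇ} = 𝓛_a`. Since `𝓛₁ = id`, it also says that `Ret (G, r_G)`
is trivial, i.e. that `Ret²` is a point, while `Ret¹` is a point exactly when `r_G` is the flip.

The hard direction is that **lri** on `G` forces the identity (`act_gLeft_of_lri`). Through the
bijective cocycle, `G` acts on `ℤ^(X)` by permuting the basis `X`, and **lri** says that `ᵃb` and
`b` have inverses acting alike on the vector of `a`. That vector can be any element of `ℤ^(X)`;
unequal coefficients, as in `2y + w`, let one read off the image of `y` (`act_gLeft_inv_single`).

For the last condition, **Raut** makes `a ↦ aᶜ` additive, hence determined by the basis `X`, where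
**lri** on `X` makes it the action of `c⁻¹` (`groupSolution_lri_of_raut`). Conversely, under **lri**
on `G` the right actions are inverse left actions, which are always additive. Restricted to
generators, the identity bounds the level of `X`. -/

instance [Nonempty X] : Nonempty (Quotient S.retSetoid) :=
  ‹Nonempty X›.map (Quotient.mk S.retSetoid)

theorem retIsPoint_one_iff [Nonempty X] : RetIsPoint 1 S ↔ ∀ x y, S.L x = S.L y := by
  change Nat.card (Quotient S.retSetoid) = 1 ↔ _
  rw [Nat.card_eq_one_iff_unique]
  constructor
  · rintro ⟨h, _⟩ x y
    exact Quotient.exact (h.elim (Quotient.mk S.retSetoid x) (Quotient.mk S.retSetoid y))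
  · intro h
    refine ⟨⟨fun p q => ?_⟩, inferInstance⟩
    induction p using Quotient.inductionOn
    induction q using Quotient.inductionOn
    exact Quotient.sound (h _ _)

/-- The one-step criterion applied to the retraction: its left map at `[x]` sends `[z]` to `[ˣz]`,
and two classes coincide exactly when their left maps on `X` do. -/
theorem retIsPoint_two_iff [Nonempty X] :
    RetIsPoint 2 S ↔ ∀ x y z, S.L (lact S.r x z) = S.L (lact S.r y z) := by
  change RetIsPoint 1 S.retract ↔ _
  rw [retIsPoint_one_iff]
  constructor
  · intro h x y z
    exact Quotient.exact (DFunLike.congr_fun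
      (h (Quotient.mk S.retSetoid x) (Quotient.mk S.retSetoid y)) (Quotient.mk S.retSetoid z))
  · intro h p q
    induction p using Quotient.inductionOn with | _ x
    induction q using Quotient.inductionOn with | _ y
    ext t
    induction t using Quotient.inductionOn with | _ z
    exact Quotient.sound (h x y z)

/-- A solution is trivial as soon as all its left actions are. -/
theorem isTrivial_iff : S.IsTrivial ↔ ∀ x, S.L x = 1 := by
  constructor
  · intro h x
    ext y
    exact congrArg Prod.fst (h x y)
  · intro h x y
    have h1 : lact S.r x y = y := DFunLike.congr_fun (h x) y
    refine Prod.ext h1 ?_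
    change ract S.r x y = x
    rw [ract_eq, h]
    rfl

/-- Condition **lri** says that `xʸ = 𝓛_y⁻¹ x`. -/
theorem lri_iff : S.Lri ↔ ∀ x y, ract S.r x y = (S.L y).symm x := by
  constructor
  · intro h x y
    rw [Equiv.eq_symm_apply]
    exact (h y x).2
  · intro h x y
    refine ⟨?_, ?_⟩
    · rw [h, Equiv.symm_apply_eq]
      rfl
    · rw [h]
      exact (S.L x).apply_symm_apply y

/-- `𝓛_{xʸ} = 𝓛ₓ` for all `x, y` if and only if `𝓛_{ˣy} = 𝓛_y` for all `x, y`. -/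
theorem L_ract_iff_L_lact :
    (∀ x y, S.L (ract S.r x y) = S.L x) ↔ ∀ x y, S.L (lact S.r x y) = S.L y := by
  constructor
  · intro h x y
    rw [← h (lact S.r x y) (ract S.r x y), rr]
  · intro h x y
    rw [← h (lact S.r x y) (ract S.r x y), ll]

/-- Involutivity gives `xʸ = 𝓛_{ˣy}⁻¹ x`, and the hypothesis replaces the index `ˣy` by `y`. -/
theorem lri_of_L_lact (h : ∀ x y, S.L (lact S.r x y) = S.L y) : S.Lri := by
  rw [lri_iff]
  intro x y
  rw [ract_eq, h]

end Retraction

/-! ### The left action of `G` seen through permutations of `X`. -/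

section StructureGroup

variable {X : Type u} (S : Solution X)

theorem permAct_inj {σ τ : Equiv.Perm X}
    (h : ∀ a : X →₀ ℤ, permAct σ a = permAct τ a) : σ = τ := by
  ext x
  have := h (Finsupp.single x 1)
  rw [permAct_single, permAct_single] at this
  exact Finsupp.single_left_injective one_ne_zero this

/-- The cocycle carries `𝓛_a` to the permutation of coordinates by `act a`; it is surjective, and a
permutation of `X` is determined by its effect on basis vectors. -/
theorem groupSolution_L_eq_iff (a b : S.StructureGroup) :
    S.groupSolution.L a = S.groupSolution.L b ↔ S.act a = S.act b := by
  constructor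
  · intro h
    apply permAct_inj
    intro v
    obtain ⟨g, rfl⟩ := S.cocycle_bijective.2 v
    rw [← cocycle_gLeft, ← cocycle_gLeft]
    exact congrArg S.cocycle (DFunLike.congr_fun h g)
  · intro h
    ext g
    change S.gLeft a g = S.gLeft b g
    rw [gLeft, gLeft, h]

theorem groupSolution_L_one : S.groupSolution.L 1 = 1 := by
  ext g
  exact S.gLeft_one g

theorem groupSolution_L_symm_apply (a b : S.StructureGroup) :
    (S.groupSolution.L a).symm b = S.gLeft a⁻¹ b := by
  rw [Equiv.symm_apply_eq]
  exact (S.gLeft_self_inv a b).symm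

theorem groupSolution_lri_iff :
    S.groupSolution.Lri ↔ ∀ a b, ract S.symmetricGroup.r a b = S.gLeft b⁻¹ a := by
  simp only [lri_iff, groupSolution_L_symm_apply]
  rfl

/-! ### Condition **lri** on `G` and the invariance of left maps. -/

/-- Under **lri** the two permutations agree on the vector of `a`. A basis vector of coefficient at
least `2` cannot be exchanged with one of coefficient at most `1`, so they agree at `y`, even when
`w = y`. -/
theorem act_gLeft_inv_single (h : S.groupSolution.Lri) (y w : X) (a b : S.StructureGroup)
    (ha : S.cocycle a = Finsupp.single y 2 + Finsupp.single w 1 ∨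
      S.cocycle a = Finsupp.single y 2) :
    S.act (S.gLeft a b)⁻¹ y = S.act b⁻¹ y := by
  classical
  -- The left side is `aᵇ` by the construction of `r_G`.
  have h1 : S.gLeft (S.gLeft a b)⁻¹ a = S.gLeft b⁻¹ a := (S.groupSolution_lri_iff.1 h) a b
  have h2 := congrArg S.cocycle h1
  rw [cocycle_gLeft, cocycle_gLeft] at h2
  generalize S.act (S.gLeft a b)⁻¹ = σ at h2
  generalize S.act b⁻¹ = τ at h2
  by_contra hne
  have hne' : τ y ≠ σ y := fun e => hne e.symm
  rcases ha with ha | ha <;> rw [ha] at h2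
  · simp only [map_add, permAct_single] at h2
    -- At `σ y` the left side has coefficient at least `2`; as `τ y ≠ σ y`, the right side has at
    -- most the `1` coming from `w`.
    have h3 := DFunLike.congr_fun h2 (σ y)
    simp only [Finsupp.add_apply, Finsupp.single_apply, if_true, if_neg hne'] at h3
    split_ifs at h3 <;> omega
  · simp only [permAct_single] at h2
    have h3 := DFunLike.congr_fun h2 (σ y)
    simp [Finsupp.single_apply, if_neg hne'] at h3

/-- Under **lri** on the structure group, `𝓛_{ᵃb} = 𝓛_b`: a permutation that fixes `2y + w` in
the free abelian group fixes `y`. -/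
theorem act_gLeft_of_lri (h : S.groupSolution.Lri) (a b : S.StructureGroup) :
    S.act (S.gLeft a b) = S.act b := by
  have gen : ∀ z b, S.act (S.gLeft (S.ι z) b) = S.act b := by
    intro z b
    suffices S.act (S.gLeft (S.ι z) b)⁻¹ = S.act b⁻¹ by
      simpa only [map_inv, inv_inj] using this
    ext y
    -- Compare `ᵘ(ᶻb)` at `y` in two ways: with `ᶻb` through the vector `2y` of `u`, and with `b`
    -- through the vector `2y + ᵘz` of `u z`.
    obtain ⟨u, hu⟩ := S.cocycle_bijective.2 (Finsupp.single y 2)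
    have h1 := S.act_gLeft_inv_single h y y u (S.gLeft (S.ι z) b) (Or.inr hu)
    have h2 := S.act_gLeft_inv_single h y (S.act u z) (u * S.ι z) b
      (Or.inl (by rw [cocycle_mul, hu, cocycle_ι, permAct_single]))
    rw [gLeft_mul, h1] at h2
    exact h2
  have ha : a ∈ Subgroup.closure (Set.range S.ι) := by rw [closure_ι]; trivial
  induction ha using Subgroup.closure_induction generalizing b with
  | mem _ hx => obtain ⟨x, rfl⟩ := hx; exact gen x b
  | one => rw [gLeft_one]
  | mul g k _ _ ihg ihk => rw [gLeft_mul, ihg, ihk]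
  | inv g _ ih => rw [← ih (S.gLeft g⁻¹ b), gLeft_self_inv]

/-- Both sides say that `act` is the trivial homomorphism, which can be checked on the generators.
-/
theorem groupSolution_isTrivial_iff : S.groupSolution.IsTrivial ↔ S.IsTrivial := by
  rw [isTrivial_iff, isTrivial_iff]
  simp only [← groupSolution_L_one, groupSolution_L_eq_iff, map_one]
  constructor
  · intro h x
    rw [← act_ι, h]
  · intro h g
    have hg : g ∈ Subgroup.closure (Set.range S.ι) := by rw [closure_ι]; trivial
    induction hg using Subgroup.closure_induction with
    | mem _ hx => obtain ⟨x, rfl⟩ := hx; rw [act_ι, h]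
    | one => exact map_one _
    | mul g k _ _ ihg ihk => rw [map_mul, ihg, ihk, one_mul]
    | inv g _ ih => rw [map_inv, ih, inv_one]

/-! ### The first three conditions as statements about `𝓛_{ᵃb} = 𝓛_b`. -/

theorem lri_iff_L_lact_groupSolution :
    S.groupSolution.Lri ↔
      ∀ a b, S.groupSolution.L (lact S.groupSolution.r a b) = S.groupSolution.L b :=
  ⟨fun h a b => (S.groupSolution_L_eq_iff _ _).2 (S.act_gLeft_of_lri h a b),
    S.groupSolution.lri_of_L_lact⟩

theorem actsNontriviallyByAutomorphisms_iff :
    S.ActsNontriviallyByAutomorphisms ↔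
      ¬ S.groupSolution.IsTrivial ∧ S.groupSolution.Lri := by
  rw [and_comm, lri_iff_L_lact_groupSolution, ← L_ract_iff_L_lact, isTrivial_iff, not_forall]
  rfl

theorem groupSolution_hasMpl_two_iff :
    S.groupSolution.HasMpl 2 ↔ ¬ S.groupSolution.IsTrivial ∧ S.groupSolution.Lri := by
  have h1 : RetIsPoint 1 S.groupSolution ↔ S.groupSolution.IsTrivial := by
    rw [retIsPoint_one_iff, isTrivial_iff]
    constructor
    · intro h a
      rw [h a 1, groupSolution_L_one]
    · intro h a b
      rw [h, h]
  have h0 : RetIsPoint 0 S.groupSolution → RetIsPoint 1 S.groupSolution := by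
    intro h
    have := (Nat.card_eq_one_iff_unique.1 h).1
    exact S.groupSolution.retIsPoint_one_iff.2 fun a b => by rw [Subsingleton.elim a b]
  have h2 : RetIsPoint 2 S.groupSolution ↔ S.groupSolution.Lri := by
    rw [retIsPoint_two_iff, lri_iff_L_lact_groupSolution]
    constructor
    · intro h a b
      -- The element `1` acts as the identity, so it serves as the reference point of comparison.
      rw [h a 1 b]
      exact congrArg S.groupSolution.L (S.gLeft_one b)
    · intro h a b c
      rw [h, h]
  constructor
  · rintro ⟨hm, hl⟩
    refine ⟨fun ht => ?_, h2.1 hm⟩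
    have : 2 ≤ 1 := hl (show RetIsPoint 1 S.groupSolution from h1.2 ht)
    omega
  · rintro ⟨ht, hl⟩
    refine ⟨h2.2 hl, fun k hk => ?_⟩
    by_contra hlt
    interval_cases k
    · exact ht (h1.1 (h0 hk))
    · exact ht (h1.1 hk)

/-! ### Additivity of the right actions (**Raut**). -/

theorem cocycle_brace_add (a b : S.StructureGroup) :
    S.cocycle (S.symmetricGroup.brace.add a b) = S.cocycle a + S.cocycle b := by
  change S.cocycle (a * S.gLeft a⁻¹ b) = _
  rw [cocycle_mul, ← cocycle_gLeft, gLeft_self_inv]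

theorem gLeft_ι (a : S.StructureGroup) (x : X) : S.gLeft a (S.ι x) = S.ι (S.act a x) := by
  apply S.cocycle_bijective.1
  simp

/-- Induction on `c`: left actions send generators to generators, so **lri** on `X` can be applied
again after each factor. For products `a` of generators this breaks down, which is where **Raut**
enters. -/
theorem ract_ι_of_lri (h : S.Lri) (x : X) (c : S.StructureGroup) :
    ract S.symmetricGroup.r (S.ι x) c = S.gLeft c⁻¹ (S.ι x) := by
  have hB := S.symmetricGroup.isBraidingOperator
  have hc : c ∈ Subgroup.closure (Set.range S.ι) := by rw [closure_ι]; trivial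
  induction hc using Subgroup.closure_induction generalizing x with
  | mem _ hy =>
    obtain ⟨y, rfl⟩ := hy
    rw [gLeft_ι, map_inv, act_ι]
    change (S.symmetricGroup.r (S.ι x, S.ι y)).2 = _
    rw [symmetricGroup_r_ι, S.lri_iff.1 h]
    rfl
  | one => rw [hB.mr0', inv_one, gLeft_one]
  | mul g k _ _ ihg ihk =>
    rw [hB.mr1, ihg, gLeft_ι, ihk, mul_inv_rev, gLeft_mul, S.gLeft_ι g⁻¹]
  | inv g _ ih =>
    -- Chosen so that acting by `g⁻¹` returns `x`: thus `x` is the image of `act g x` under the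
    -- right action of `g`, and the right action of `g⁻¹` undoes it.
    have h1 := ih (S.act g x)
    rw [← gLeft_ι, ← gLeft_mul, inv_mul_cancel, gLeft_one] at h1
    conv_lhs => rw [← h1]
    rw [← hB.mr1, mul_inv_cancel, hB.mr0', inv_inv]

/-- **lri** on `X` spreads to `G` when the right actions are additive. -/
theorem groupSolution_lri_of_raut (h : S.Lri) (hR : S.symmetricGroup.Raut) :
    S.groupSolution.Lri := by
  rw [groupSolution_lri_iff]
  intro a c
  -- The right action of `c` transported to `ℤ^(X)`; the cocycle turns brace addition into addition
  -- of vectors, so **Raut** is exactly its additivity.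
  let f : (X →₀ ℤ) →+ (X →₀ ℤ) := AddMonoidHom.mk'
    (fun v => S.cocycle (ract S.symmetricGroup.r (S.cocycleEquiv.symm v) c)) (by
      intro v w
      have e : S.cocycleEquiv.symm (v + w) =
          S.symmetricGroup.brace.add (S.cocycleEquiv.symm v) (S.cocycleEquiv.symm w) := by
        rw [Equiv.symm_apply_eq]
        change _ = S.cocycle _
        rw [cocycle_brace_add]
        exact congrArg₂ _ (S.cocycleEquiv.apply_symm_apply v).symm
          (S.cocycleEquiv.apply_symm_apply w).symm
      rw [e, hR, cocycle_brace_add])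
  have hf : f = (permAct (S.act c⁻¹)).toAddMonoidHom := by
    refine Finsupp.addHom_ext' fun x => AddMonoidHom.ext_int ?_
    have e : S.cocycleEquiv.symm (Finsupp.single x 1) = S.ι x := by
      rw [Equiv.symm_apply_eq]
      exact (S.cocycle_ι x).symm
    change S.cocycle (ract S.symmetricGroup.r (S.cocycleEquiv.symm (Finsupp.single x 1)) c) =
      permAct (S.act c⁻¹) (Finsupp.single x 1)
    rw [e, S.ract_ι_of_lri h, cocycle_gLeft, cocycle_ι]
  apply S.cocycle_bijective.1
  rw [cocycle_gLeft]
  have h1 := DFunLike.congr_fun hf (S.cocycle a)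
  have e : S.cocycleEquiv.symm (S.cocycle a) = a := S.cocycleEquiv.symm_apply_apply a
  change S.cocycle (ract S.symmetricGroup.r (S.cocycleEquiv.symm (S.cocycle a)) c) = _ at h1
  rw [e] at h1
  exact h1

/-- Here `aᶜ` is the left action of `c⁻¹` on `a`, and left actions respect brace addition in every
symmetric group. -/
theorem raut_of_groupSolution_lri (h : S.groupSolution.Lri) : S.symmetricGroup.Raut := by
  rw [groupSolution_lri_iff] at h
  intro a b c
  rw [h, h, h]
  exact S.symmetricGroup.lact_mul_lact_inv c⁻¹ a b

/-! ### Consequences for `(X, r)` and the final equivalence. -/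

theorem L_lact_of_groupSolution_lri (h : S.groupSolution.Lri) (x y : X) :
    S.L (lact S.r x y) = S.L y := by
  have := S.act_gLeft_of_lri h (S.ι x) (S.ι y)
  rwa [gLeft_ι, act_ι, act_ι, act_ι] at this

theorem groupSolution_lri_iff_raut :
    S.groupSolution.Lri ↔ S.Lri ∧ S.symmetricGroup.Raut :=
  ⟨fun h => ⟨S.lri_of_L_lact (S.L_lact_of_groupSolution_lri h), S.raut_of_groupSolution_lri h⟩,
    fun h => S.groupSolution_lri_of_raut h.1 h.2⟩

theorem exists_hasMpl_le_two [Nonempty X] (h : S.groupSolution.Lri) :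
    ∃ m, m ≤ 2 ∧ S.HasMpl m := by
  classical
  have h2 : RetIsPoint 2 S := S.retIsPoint_two_iff.2 fun x y z => by
    rw [S.L_lact_of_groupSolution_lri h, S.L_lact_of_groupSolution_lri h]
  have hex : ∃ m, RetIsPoint m S := ⟨2, h2⟩
  exact ⟨Nat.find hex, Nat.find_min' hex h2, Nat.find_spec hex, fun _ hk => Nat.find_min' hex hk⟩

end StructureGroup

end Solution

end YangBaxter

theorem theorem3p1 {X : Type*} [Nonempty X] (S : YangBaxter.Solution X) :
    List.TFAE
      [ ¬ S.groupSolution.IsTrivial ∧ S.groupSolution.Lri,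
        S.groupSolution.HasMpl 2,
        S.ActsNontriviallyByAutomorphisms,
        ¬ S.IsTrivial ∧ S.Lri ∧ S.symmetricGroup.Raut ] ∧
    ((¬ S.groupSolution.IsTrivial ∧ S.groupSolution.Lri) ∨
        S.groupSolution.HasMpl 2 ∨
        S.ActsNontriviallyByAutomorphisms ∨
        (¬ S.IsTrivial ∧ S.Lri ∧ S.symmetricGroup.Raut) →
      ∃ m, m ≤ 2 ∧ S.HasMpl m) := by
  have h2 := S.groupSolution_hasMpl_two_iff
  have h3 := S.actsNontriviallyByAutomorphisms_iff
  have h4 : (¬ S.IsTrivial ∧ S.Lri ∧ S.symmetricGroup.Raut) ↔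
      ¬ S.groupSolution.IsTrivial ∧ S.groupSolution.Lri := by
    rw [S.groupSolution_isTrivial_iff, S.groupSolution_lri_iff_raut]
  -- Every condition becomes the first one, so the equivalence is immediate and all cases of the
  -- bound coincide.
  rw [h2, h3, h4]
  refine ⟨?_, ?_⟩
  · tfae_finish
  · rintro (h | h | h | h) <;> exact S.exists_hasMpl_le_two h.2
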